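/- Let $\mathcal D^{\rm LSL}$ be the set of all functions $\delta:[0,1]\to[0,1]$ that are non-decreasing and $2$-Lipschitz, satisfy $\delta(1)=1$ and $\delta(t)\le t$ for all $t\in[0,1]$, and are such that $t\mapsto \delta(t)/t$ is non-decreasing and $t\mapsto\delta(t)/t^2$ is non-increasing on $(0,1]$. For $\delta\in\mathcal D^{\rm LSL}$ the lower semilinear copula $S_\delta:[0,1]^2\to[0,1]$ is defined by $$S_\delta(u,v)=\begin{cases} v\,\dfrac{\delta(u)}{u} & \text{if } v\le u,\\[1ex] u\,\dfrac{\delta(v)}{v} & \text{otherwise,}\end{cases}\qquad S_\delta(0,0)=0 .$$ For a bivariate copula $C$ let $\rho(C)=12\int_0^1\!\int_0^1 C(u,v)\,\mathrm dv\,\mathrm du-3$ be Spearman's rho, and let $$\xi(C)=\frac{\int_{\mathbb R}\operatorname{var}\bigl(P(Y\ge y\mid X)\bigr)\,\mathrm dP^{Y}(y)}{\int_{\mathbb R}\operatorname{var}\bigl(\mathbf 1_{\{Y\ge y\}}\bigr)\,\mathrm dP^{Y}(y)}$$ be Chatterjee's rank correlation, where $X,Y$ are real random variables on a probability space with continuous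 distribution functions $F,G$ and joint distribution function $(x,y)\mapsto C(F(x),G(y))$. Then, for every $\delta\in\mathcal D^{\rm LSL}$, such a pair $(X,Y)$ with $C=S_\delta$ exists, and for every such pair $$\xi(S_\delta)\le\rho(S_\delta).$$ The inequality is sharp: for every $r\in[0,1]$ there is $\delta\in\mathcal D^{\rm LSL}$ such that $\rho(S_\delta)=r$ and $\xi(S_\delta)=r$ for every such pair. -/

import Mathlib

open MeasureTheory ProbabilityTheory Set

noncomputable section

/-- The class of diagonals of lower semilinear copulas. A copula diagonal is a function
`δ : [0,1] → [0,1]` that is non-decreasing, 2-Lipschitz, with `δ t ≤ t` and `δ 1 = 1`; in addition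
`δ t / t` is non-decreasing and `δ t / t ^ 2` is non-increasing on `(0,1]`.
Values of `δ` outside `[0,1]` are irrelevant. -/
structure IsLSLDiagonal (δ : ℝ → ℝ) : Prop where
  mapsTo : MapsTo δ (Icc 0 1) (Icc 0 1)
  monotoneOn : MonotoneOn δ (Icc 0 1)
  lipschitzOn : LipschitzOnWith 2 δ (Icc 0 1)
  le_self : ∀ t ∈ Icc (0 : ℝ) 1, δ t ≤ t
  map_one : δ 1 = 1
  monotoneOn_div : MonotoneOn (fun t => δ t / t) (Ioc 0 1)
  antitoneOn_div_sq : AntitoneOn (fun t => δ t / t ^ 2) (Ioc 0 1)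

/-- The lower semilinear copula `S_δ` on `[0,1]²`; at the origin its value is `0`. -/
def lslCopula (δ : ℝ → ℝ) (u v : ℝ) : ℝ :=
  if v ≤ u then v * (δ u / u) else u * (δ v / v)

/-- Spearman's rho of a bivariate copula: `12 ∫∫_{[0,1]²} C(u,v) du dv - 3`. -/
def spearmanRho (C : ℝ → ℝ → ℝ) : ℝ :=
  12 * (∫ u in Icc (0 : ℝ) 1, ∫ v in Icc (0 : ℝ) 1, C u v) - 3

/-- `X` and `Y` are real random variables with continuous distribution functions `F` and `G`
whose joint distribution function is `(x, y) ↦ C (F x) (G y)`. -/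
structure HasCopula {Ω : Type*} [MeasurableSpace Ω] (P : Measure Ω) (X Y : Ω → ℝ)
    (C : ℝ → ℝ → ℝ) : Prop where
  measurable_fst : Measurable X
  measurable_snd : Measurable Y
  continuous_fst : Continuous fun x : ℝ => P.real {ω | X ω ≤ x}
  continuous_snd : Continuous fun y : ℝ => P.real {ω | Y ω ≤ y}
  joint : ∀ x y : ℝ, P.real {ω | X ω ≤ x ∧ Y ω ≤ y} =
    C (P.real {ω | X ω ≤ x}) (P.real {ω | Y ω ≤ y})

/-- Chatterjee's rank correlation of `Y` on `X`:
`∫ var (P(Y ≥ y | X)) dP^Y(y) / ∫ var (1_{Y ≥ y}) dP^Y(y)`, where `P(Y ≥ y | X)` is the conditional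
expectation of the indicator of `{Y ≥ y}` given the σ-algebra generated by `X`. -/
def chatterjeeXi {Ω : Type*} [MeasurableSpace Ω] (P : Measure Ω) (X Y : Ω → ℝ) : ℝ :=
  (∫ y, variance
      (condExp (MeasurableSpace.comap X inferInstance) P
        ({ω | y ≤ Y ω}.indicator fun _ => (1 : ℝ))) P ∂(P.map Y)) /
    (∫ y, variance ({ω | y ≤ Y ω}.indicator fun _ => (1 : ℝ)) P ∂(P.map Y))

end

/-! Put `f t = δ t / t` and `g = f'`, so that the copula is `min u v * f (max u v)`. Its partial
derivative in `u` is `f v` for `u ≤ v` and `v * g u` for `v < u`. Since `F(X)` and `G(Y)` are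
uniform and `P(Y ≤ y | X)` is this derivative at `(F(X), G(y))`, ξ equals `6 ∫∫ (∂₁C)² - 2`, which
folding along the diagonal turns into a single integral in `f` and `g`; ρ becomes `12 ∫ u² f - 3`.
The two are compared through the exact derivative of `4 t² δ - 3 δ²`, whose integral over `[0,1]` is
1. Using it to eliminate the terms without `g` gives `ρ - ξ = ∫ 2 u² g (3 f - 2 u - u g)`.
Monotonicity of `δ/t` gives `g ≥ 0`, that of `δ/t²` gives `u g ≤ f` and, compared with its value at
1, `u ≤ f`; hence the integrand is nonnegative (`spearmanRho_sub_chatterjeeXi`). The integrand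
vanishes where `g = 0` or where `f = u` and `g = 1`, which leads to `f = max c u` and `ρ = ξ = c⁴`.
Existence of a pair comes from an explicit measure with a density off the diagonal and a singular
part on it (`semilinearMeasure`). -/

/-- `f` is the ratio `δ t / t` of the diagonal of a lower semilinear copula and `g` its derivative,
both extended by zero outside `(0,1]`. -/
structure IsSemilinearSlope (f g : ℝ → ℝ) : Prop where
  measurable_ratio : Measurable f
  measurable_slope : Measurable g
  ratio_nonneg : ∀ u, 0 ≤ f u
  ratio_le_one : ∀ u, f u ≤ 1
  ratio_one : f 1 = 1
  ratio_of_notMem : ∀ u ∉ Ioc (0 : ℝ) 1, f u = 0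
  slope_of_notMem : ∀ u ∉ Ioc (0 : ℝ) 1, g u = 0
  slope_nonneg : ∀ u, 0 ≤ g u
  mul_slope_le : ∀ u ∈ Ioc (0 : ℝ) 1, u * g u ≤ f u
  self_le_ratio : ∀ u ∈ Ioc (0 : ℝ) 1, u ≤ f u
  intervalIntegrable : ∀ a b : ℝ, 0 < a → a ≤ b → b ≤ 1 → IntervalIntegrable g volume a b
  integral_slope : ∀ a b : ℝ, 0 < a → a ≤ b → b ≤ 1 → ∫ u in a..b, g u = f b - f a
  integral_potential :
    ∫ u in (0 : ℝ)..1, (12 * (u ^ 2 * f u) + 4 * (u ^ 3 * g u) - 6 * (u * f u ^ 2)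
      - 6 * (u ^ 2 * (f u * g u))) = 1

/-! ### Ratio and slope of a diagonal -/

open Classical in
/-- The ratio `δ t / t` on `(0,1]`, extended by zero. -/
noncomputable def diagRatio (δ : ℝ → ℝ) (u : ℝ) : ℝ :=
  if u ∈ Ioc (0 : ℝ) 1 then δ (max 0 (min 1 u)) / u else 0

open Classical in
/-- The derivative of `δ t / t` at the points of differentiability in `(0,1)`, zero elsewhere. -/
noncomputable def diagSlope (δ : ℝ → ℝ) (u : ℝ) : ℝ :=
  if u ∈ Ioo (0 : ℝ) 1 ∧ DifferentiableAt ℝ (fun t => δ (max 0 (min 1 t))) u then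
    (deriv (fun t => δ (max 0 (min 1 t))) u - diagRatio δ u) / u else 0

namespace IsLSLDiagonal

variable {δ : ℝ → ℝ}

lemma map_zero (h : IsLSLDiagonal δ) : δ 0 = 0 :=
  le_antisymm (h.le_self 0 (by simp)) (h.mapsTo (by simp : (0 : ℝ) ∈ Icc (0 : ℝ) 1)).1

lemma sq_le (h : IsLSLDiagonal δ) {u : ℝ} (hu : u ∈ Ioc (0 : ℝ) 1) : u ^ 2 ≤ δ u := by
  have h1 := h.antitoneOn_div_sq hu (by simp : (1 : ℝ) ∈ Ioc (0 : ℝ) 1) hu.2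
  have hp : 0 < u ^ 2 := pow_pos hu.1 2
  simp only [h.map_one, one_pow, div_one] at h1
  rwa [le_div_iff₀ hp, one_mul] at h1

lemma clamp_eq {u : ℝ} (hu : u ∈ Icc (0 : ℝ) 1) : max 0 (min 1 u) = u := by
  rw [min_eq_right hu.2, max_eq_right hu.1]

lemma diagRatio_eq {u : ℝ} (hu : u ∈ Ioc (0 : ℝ) 1) : diagRatio δ u = δ u / u := by
  rw [diagRatio, if_pos hu, clamp_eq (Ioc_subset_Icc_self hu)]

/-- Nothing is known about `δ` outside `[0,1]`. Clamping the argument gives a function continuous on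
all of `ℝ`, hence measurable and with a measurable derivative. -/
lemma continuous_clamp (h : IsLSLDiagonal δ) : Continuous fun t => δ (max 0 (min 1 t)) :=
  h.lipschitzOn.continuousOn.comp_continuous (by fun_prop)
    fun t => ⟨le_max_left _ _, max_le zero_le_one (min_le_left _ _)⟩

/-- The Lipschitz bound is used only here: it supplies differentiability almost everywhere and the
fundamental theorem of calculus. -/
lemma absolutelyContinuous (h : IsLSLDiagonal δ) {a b : ℝ} (ha : 0 ≤ a) (hab : a ≤ b)
    (hb : b ≤ 1) :
    AbsolutelyContinuousOnInterval (fun t => δ (max 0 (min 1 t))) a b := by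
  apply LipschitzOnWith.absolutelyContinuousOnInterval (K := 2)
  rw [uIcc_of_le hab]
  intro x hx y hy
  have hx' : x ∈ Icc (0 : ℝ) 1 := ⟨ha.trans hx.1, hx.2.trans hb⟩
  have hy' : y ∈ Icc (0 : ℝ) 1 := ⟨ha.trans hy.1, hy.2.trans hb⟩
  simp only [clamp_eq hx', clamp_eq hy']
  exact h.lipschitzOn hx' hy'

lemma hasDerivAt_clamp {u : ℝ} (hu : u ∈ Ioo (0 : ℝ) 1)
    (hd : DifferentiableAt ℝ (fun t => δ (max 0 (min 1 t))) u) :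
    HasDerivAt (fun t => δ (max 0 (min 1 t))) (u * diagSlope δ u + diagRatio δ u) u := by
  have := hd.hasDerivAt
  rw [diagSlope, if_pos ⟨hu, hd⟩]
  rwa [mul_div_cancel₀ _ hu.1.ne', sub_add_cancel]

lemma hasDerivAt_ratio {u : ℝ} (hu : u ∈ Ioo (0 : ℝ) 1)
    (hd : DifferentiableAt ℝ (fun t => δ (max 0 (min 1 t))) u) :
    HasDerivAt (fun t => δ t / t) (diagSlope δ u) u := by
  have h1 := (hasDerivAt_clamp hu hd).div (hasDerivAt_id u) hu.1.ne'
  have h2 : (fun t => δ t / t) =ᶠ[nhds u] (fun t => δ (max 0 (min 1 t)) / id t) := by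
    filter_upwards [isOpen_Ioo.mem_nhds hu] with t ht
    rw [clamp_eq (Ioo_subset_Icc_self ht), id]
  refine (h1.congr_of_eventuallyEq h2).congr_deriv ?_
  have : δ (max 0 (min 1 u)) = u * diagRatio δ u := by
    rw [diagRatio_eq (Ioo_subset_Ioc_self hu), clamp_eq (Ioo_subset_Icc_self hu)]
    field_simp [hu.1.ne']
  simp only [this, id]
  field_simp [hu.1.ne']
  ring

lemma diagSlope_nonneg (h : IsLSLDiagonal δ) (u : ℝ) : 0 ≤ diagSlope δ u := by
  by_cases hu : u ∈ Ioo (0 : ℝ) 1 ∧ DifferentiableAt ℝ (fun t => δ (max 0 (min 1 t))) u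
  · have hd := (hasDerivAt_ratio hu.1 hu.2).hasDerivWithinAt (s := Ioo 0 1)
    rw [← hd.derivWithin (isOpen_Ioo.uniqueDiffWithinAt hu.1)]
    exact (h.monotoneOn_div.mono Ioo_subset_Ioc_self).derivWithin_nonneg
  · rw [diagSlope, if_neg hu]

lemma diagRatio_nonneg (h : IsLSLDiagonal δ) (u : ℝ) : 0 ≤ diagRatio δ u := by
  by_cases hu : u ∈ Ioc (0 : ℝ) 1
  · rw [diagRatio_eq hu]
    exact div_nonneg (h.mapsTo (Ioc_subset_Icc_self hu)).1 hu.1.le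
  · rw [diagRatio, if_neg hu]

/-- The derivative of `δ t / t ^ 2 = f t / t` is `(t g - f) / t ^ 2`, which is nonpositive for an
antitone function. -/
lemma mul_diagSlope_le (h : IsLSLDiagonal δ) {u : ℝ} :
    u * diagSlope δ u ≤ diagRatio δ u := by
  by_cases hu : u ∈ Ioo (0 : ℝ) 1 ∧ DifferentiableAt ℝ (fun t => δ (max 0 (min 1 t))) u
  · have hu0 := hu.1.1
    have h1 := ((hasDerivAt_ratio hu.1 hu.2).div (hasDerivAt_id u) hu0.ne')
    have h2 : (fun t => δ t / t ^ 2) = ((fun t => δ t / t) / id) := by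
      ext t
      simp [div_div, sq]
    rw [← h2] at h1
    have hd := h1.hasDerivWithinAt (s := Ioo 0 1)
    have h3 := hd.derivWithin (isOpen_Ioo.uniqueDiffWithinAt hu.1)
    have h4 := (h.antitoneOn_div_sq.mono Ioo_subset_Ioc_self).derivWithin_nonpos (x := u)
    rw [h3, div_le_iff₀ (by simp only [id]; positivity)] at h4
    rw [diagRatio_eq (Ioo_subset_Ioc_self hu.1)]
    simp only [id] at h4
    linarith
  · rw [diagSlope, if_neg hu, mul_zero]
    exact h.diagRatio_nonneg u

lemma measurable_diagRatio (h : IsLSLDiagonal δ) : Measurable (diagRatio δ) :=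
  Measurable.ite measurableSet_Ioc (h.continuous_clamp.measurable.div measurable_id)
    measurable_const

lemma measurable_diagSlope (h : IsLSLDiagonal δ) : Measurable (diagSlope δ) :=
  Measurable.ite (measurableSet_Ioo.inter (measurableSet_of_differentiableAt ℝ _))
    (((measurable_deriv _).sub h.measurable_diagRatio).div measurable_id) measurable_const

lemma ae_differentiableAt (h : IsLSLDiagonal δ) :
    ∀ᵐ u, u ∈ Ioc (0 : ℝ) 1 → u ∈ Ioo (0 : ℝ) 1 ∧
      DifferentiableAt ℝ (fun t => δ (max 0 (min 1 t))) u := by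
  have h1 : ∀ᵐ u : ℝ, u ≠ 1 := by simp [ae_iff, measure_singleton]
  filter_upwards [(h.absolutelyContinuous le_rfl zero_le_one le_rfl).ae_differentiableAt, h1]
    with u hu hu1 hmem
  refine ⟨⟨hmem.1, lt_of_le_of_ne hmem.2 hu1⟩, hu ?_⟩
  rw [uIcc_of_le zero_le_one]
  exact Ioc_subset_Icc_self hmem

/-- Away from 0 the ratio is a product of the absolutely continuous functions `δ` and `1/t`. The
endpoint 0 is excluded: for `δ t = t` the ratio jumps there from 0 to 1. -/
lemma integral_diagSlope (h : IsLSLDiagonal δ) {a b : ℝ} (ha : 0 < a) (hab : a ≤ b) (hb : b ≤ 1) :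
    IntervalIntegrable (diagSlope δ) volume a b ∧
      ∫ u in a..b, diagSlope δ u = diagRatio δ b - diagRatio δ a := by
  have hinv : AbsolutelyContinuousOnInterval (fun t : ℝ => t⁻¹) a b := by
    apply ContDiffOn.absolutelyContinuousOnInterval
    apply contDiffOn_id.inv
    rw [uIcc_of_le hab]
    exact fun x hx => (ha.trans_le hx.1).ne'
  have hmul := (h.absolutelyContinuous ha.le hab hb).fun_mul hinv
  have hae : ∀ᵐ u, u ∈ uIoc a b →
      deriv (fun t => δ (max 0 (min 1 t)) * t⁻¹) u = diagSlope δ u := by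
    filter_upwards [h.ae_differentiableAt] with u hu hmem
    rw [uIoc_of_le hab] at hmem
    obtain ⟨hu1, hu2⟩ := hu ⟨ha.trans hmem.1, hmem.2.trans hb⟩
    refine HasDerivAt.deriv ((hasDerivAt_ratio hu1 hu2).congr_of_eventuallyEq ?_)
    filter_upwards [isOpen_Ioo.mem_nhds hu1] with t ht
    rw [clamp_eq (Ioo_subset_Icc_self ht), div_eq_mul_inv]
  refine ⟨hmul.intervalIntegrable_deriv.congr_ae ?_, ?_⟩
  · rwa [Filter.EventuallyEq, ae_restrict_iff' measurableSet_uIoc]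
  · rw [← intervalIntegral.integral_congr_ae hae, hmul.integral_deriv_eq_sub,
      diagRatio_eq ⟨ha.trans_le hab, hb⟩, diagRatio_eq ⟨ha, hab.trans hb⟩,
      clamp_eq ⟨(ha.trans_le hab).le, hb⟩, clamp_eq ⟨ha.le, hab.trans hb⟩]
    simp [div_eq_mul_inv]

/-- The integrand is the derivative of `4 t² δ - 3 δ²` after substituting `δ = t f` and `δ' = f + t
g`; the boundary values are 0 and `4 - 3 = 1`. -/
lemma integral_potential (h : IsLSLDiagonal δ) :
    ∫ u in (0 : ℝ)..1, (12 * (u ^ 2 * diagRatio δ u) + 4 * (u ^ 3 * diagSlope δ u)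
      - 6 * (u * diagRatio δ u ^ 2) - 6 * (u ^ 2 * (diagRatio δ u * diagSlope δ u))) = 1 := by
  have hD := h.absolutelyContinuous le_rfl zero_le_one le_rfl
  have hsq : AbsolutelyContinuousOnInterval (fun t : ℝ => t ^ 2) 0 1 :=
    ContDiffOn.absolutelyContinuousOnInterval (by fun_prop)
  have hΦ := ((hsq.fun_mul hD).const_mul 4).fun_sub ((hD.fun_mul hD).const_mul 3)
  have hI := hΦ.integral_deriv_eq_sub
  rw [clamp_eq (by simp : (1 : ℝ) ∈ Icc (0 : ℝ) 1), clamp_eq (by simp : (0 : ℝ) ∈ Icc (0 : ℝ) 1),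
    h.map_zero, h.map_one] at hI
  norm_num only at hI
  refine Eq.trans (intervalIntegral.integral_congr_ae ?_) hI
  filter_upwards [h.ae_differentiableAt] with u hu hmem
  rw [uIoc_of_le zero_le_one] at hmem
  obtain ⟨hu1, hu2⟩ := hu hmem
  have hd := hasDerivAt_clamp hu1 hu2
  have hval : δ (max 0 (min 1 u)) = u * diagRatio δ u := by
    rw [diagRatio_eq hmem, clamp_eq (Ioc_subset_Icc_self hmem)]
    field_simp [hmem.1.ne']
  have := ((((hasDerivAt_pow 2 u).fun_mul hd).const_mul 4).fun_sub
    ((hd.fun_mul hd).const_mul 3)).deriv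
  refine Eq.trans ?_ this.symm
  rw [hval]
  push_cast
  ring

theorem isSemilinearSlope (h : IsLSLDiagonal δ) :
    IsSemilinearSlope (diagRatio δ) (diagSlope δ) where
  measurable_ratio := h.measurable_diagRatio
  measurable_slope := h.measurable_diagSlope
  ratio_nonneg := h.diagRatio_nonneg
  ratio_le_one u := by
    by_cases hu : u ∈ Ioc (0 : ℝ) 1
    · rw [diagRatio_eq hu]
      exact div_le_one_of_le₀ (h.le_self u (Ioc_subset_Icc_self hu)) hu.1.le
    · rw [diagRatio, if_neg hu]
      exact zero_le_one
  ratio_one := by rw [diagRatio_eq (by simp), h.map_one, div_one]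
  ratio_of_notMem u hu := if_neg hu
  slope_of_notMem u hu := if_neg fun hu' => hu (Ioo_subset_Ioc_self hu'.1)
  slope_nonneg := h.diagSlope_nonneg
  mul_slope_le _ _ := h.mul_diagSlope_le
  self_le_ratio u hu := by
    rw [diagRatio_eq hu, le_div_iff₀ hu.1, ← sq]
    exact h.sq_le hu
  intervalIntegrable _ _ ha hab hb := (h.integral_diagSlope ha hab hb).1
  integral_slope _ _ ha hab hb := (h.integral_diagSlope ha hab hb).2
  integral_potential := h.integral_potential

end IsLSLDiagonal

/-! ### Continuous distribution functions and the uniform law -/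

lemma Iic_inter_Ioc_zero_one (a : ℝ) : Iic a ∩ Ioc 0 1 = Ioc 0 (min a 1) := by
  ext x
  simp only [mem_inter_iff, mem_Iic, mem_Ioc, le_min_iff]
  tauto

section DistributionFunction

variable {Ω : Type*} [MeasurableSpace Ω] {P : Measure Ω} [IsProbabilityMeasure P] {X : Ω → ℝ}

lemma measureReal_le_eq_cdf (hX : Measurable X) (x : ℝ) :
    P.real {ω | X ω ≤ x} = cdf (P.map X) x := by
  have := Measure.isProbabilityMeasure_map (μ := P) hX.aemeasurable
  rw [cdf_eq_real, map_measureReal_apply hX measurableSet_Iic]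
  rfl

lemma monotone_measureReal_le : Monotone fun x : ℝ => P.real {ω | X ω ≤ x} :=
  fun _ _ hab => measureReal_mono fun _ hω => le_trans hω hab

/-- `F` may have flat pieces, so it need not be invertible. The largest point `s` with `F s ≤ a`
replaces the inverse: continuity gives `F s = a`, and `F(X) ≤ a` is the same event as `X ≤ s`. -/
lemma measureReal_distribution_le (hX : Measurable X)
    (hc : Continuous fun x : ℝ => P.real {ω | X ω ≤ x}) {a : ℝ} (ha : a ∈ Ioo (0 : ℝ) 1) :
    P.real {ω | P.real {ω' | X ω' ≤ X ω} ≤ a} = a := by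
  set F : ℝ → ℝ := fun x => P.real {ω | X ω ≤ x} with hF
  have hmono : Monotone F := monotone_measureReal_le
  have hFc : F = cdf (P.map X) := funext (measureReal_le_eq_cdf hX)
  have hbot : ∀ᶠ x in Filter.atBot, F x < a := by
    rw [hFc]
    exact (tendsto_cdf_atBot _).eventually_lt_const ha.1
  have htop : ∀ᶠ x in Filter.atTop, a < F x := by
    rw [hFc]
    exact (tendsto_cdf_atTop _).eventually_const_lt ha.2
  obtain ⟨b, hb⟩ := hbot.exists
  obtain ⟨t, ht⟩ := htop.exists
  obtain ⟨x₀, hx₀⟩ := mem_range_of_exists_le_of_exists_ge hc ⟨b, hb.le⟩ ⟨t, ht.le⟩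
  have hne : {x | F x ≤ a}.Nonempty := ⟨b, hb.le⟩
  have hbdd : BddAbove {x | F x ≤ a} :=
    ⟨t, fun x hx => le_of_not_gt fun h => absurd (hmono h.le) (not_le.2 (lt_of_le_of_lt hx ht))⟩
  have hmem := (isClosed_le hc continuous_const).csSup_mem hne hbdd
  have hs : F (sSup {x | F x ≤ a}) = a :=
    le_antisymm hmem (hx₀.symm.le.trans (hmono (le_csSup hbdd hx₀.le)))
  have hset : {ω | P.real {ω' | X ω' ≤ X ω} ≤ a} = {ω | X ω ≤ sSup {x | F x ≤ a}} := by
    ext ω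
    exact ⟨fun h => le_csSup hbdd h, fun h => (hmono h).trans hmem⟩
  rw [hset]
  exact hs

lemma measurable_distribution (hX : Measurable X) :
    Measurable fun ω => P.real {ω' | X ω' ≤ X ω} :=
  (monotone_measureReal_le (P := P) (X := X)).measurable.comp hX

/-- Probability integral transform. -/
theorem map_distribution_eq_uniform (hX : Measurable X)
    (hc : Continuous fun x : ℝ => P.real {ω | X ω ≤ x}) :
    P.map (fun ω => P.real {ω' | X ω' ≤ X ω}) = volume.restrict (Ioc (0 : ℝ) 1) := by
  have hm := measurable_distribution (P := P) hX
  have hprob := Measure.isProbabilityMeasure_map (μ := P) hm.aemeasurable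
  have hio : ∀ a ∈ Ioo (0 : ℝ) 1,
      P {ω | P.real {ω' | X ω' ≤ X ω} ≤ a} = ENNReal.ofReal a := fun a ha => by
    rw [← ofReal_measureReal, measureReal_distribution_le hX hc ha]
  refine Measure.ext_of_Iic _ _ fun a => ?_
  rw [Measure.map_apply hm measurableSet_Iic, Measure.restrict_apply measurableSet_Iic,
    Iic_inter_Ioc_zero_one, Real.volume_Ioc, sub_zero]
  change P {ω | P.real {ω' | X ω' ≤ X ω} ≤ a} = _
  rcases le_or_gt a 0 with h0 | h0
  -- The level 0 lies outside the open interval already treated, so the probability is squeezed by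
  -- arbitrarily small positive levels.
  · rw [ENNReal.ofReal_of_nonpos ((min_le_left _ _).trans h0)]
    refine le_antisymm (ENNReal.le_of_forall_pos_le_add fun ε hε _ => ?_) zero_le
    rw [zero_add]
    have hb : min (ε : ℝ) (1 / 2) ∈ Ioo (0 : ℝ) 1 :=
      ⟨lt_min hε (by norm_num), (min_le_right _ _).trans_lt (by norm_num)⟩
    calc P {ω | P.real {ω' | X ω' ≤ X ω} ≤ a}
        ≤ P {ω | P.real {ω' | X ω' ≤ X ω} ≤ min (ε : ℝ) (1 / 2)} :=
          measure_mono fun ω hω => le_trans hω (h0.trans hb.1.le)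
      _ = ENNReal.ofReal (min (ε : ℝ) (1 / 2)) := hio _ hb
      _ ≤ ENNReal.ofReal ε := ENNReal.ofReal_le_ofReal (min_le_left _ _)
      _ = ε := ENNReal.ofReal_coe_nnreal
  rcases lt_or_ge a 1 with h1 | h1
  · rw [min_eq_left h1.le, hio a ⟨h0, h1⟩]
  · rw [min_eq_right h1, ENNReal.ofReal_one, ← measure_univ (μ := P)]
    congr 1
    ext ω
    simpa using measureReal_le_one.trans h1

lemma integral_comp_distribution (hX : Measurable X)
    (hc : Continuous fun x : ℝ => P.real {ω | X ω ≤ x}) {φ : ℝ → ℝ} (hφ : Measurable φ) :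
    ∫ ω, φ (P.real {ω' | X ω' ≤ X ω}) ∂P = ∫ u in Ioc (0 : ℝ) 1, φ u := by
  rw [← map_distribution_eq_uniform hX hc,
    integral_map (measurable_distribution hX).aemeasurable hφ.aestronglyMeasurable]

lemma integral_map_comp_distribution (hX : Measurable X)
    (hc : Continuous fun x : ℝ => P.real {ω | X ω ≤ x}) {φ : ℝ → ℝ} (hφ : Measurable φ) :
    ∫ x, φ (P.real {ω | X ω ≤ x}) ∂(P.map X) = ∫ u in Ioc (0 : ℝ) 1, φ u := by
  rw [← integral_comp_distribution hX hc hφ, integral_map hX.aemeasurable]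
  exact (hφ.comp monotone_measureReal_le.measurable).aestronglyMeasurable

lemma measure_eq_zero_of_continuous (hX : Measurable X)
    (hc : Continuous fun x : ℝ => P.real {ω | X ω ≤ x}) (x : ℝ) : P {ω | X ω = x} = 0 := by
  have h : P ((fun ω => P.real {ω' | X ω' ≤ X ω}) ⁻¹' {P.real {ω | X ω ≤ x}}) = 0 := by
    rw [← Measure.map_apply (measurable_distribution hX) (measurableSet_singleton _),
      map_distribution_eq_uniform hX hc]
    exact measure_singleton _
  refine measure_mono_null (fun ω hω => ?_) h
  rw [mem_ofPred_eq] at hω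
  simp [hω]

/-- The first event lies in the second and both have probability `F x`. They can differ where `F` is
flat to the right of `x`. -/
lemma setOf_le_ae_eq_distribution (hX : Measurable X)
    (hc : Continuous fun x : ℝ => P.real {ω | X ω ≤ x}) (x : ℝ) :
    {ω | X ω ≤ x} =ᵐ[P]
      (fun ω => P.real {ω' | X ω' ≤ X ω}) ⁻¹' Iic (P.real {ω | X ω ≤ x}) := by
  refine ae_eq_of_subset_of_measure_ge (fun ω hω => monotone_measureReal_le hω) ?_
    (hX measurableSet_Iic).nullMeasurableSet (measure_ne_top _ _)
  rw [← Measure.map_apply (measurable_distribution hX) measurableSet_Iic,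
    map_distribution_eq_uniform hX hc, Measure.restrict_apply measurableSet_Iic, Iic_inter_Ioc_zero_one,
    Real.volume_Ioc, sub_zero, min_eq_left measureReal_le_one, ofReal_measureReal]

lemma setIntegral_comp_distribution (hX : Measurable X)
    (hc : Continuous fun x : ℝ => P.real {ω | X ω ≤ x}) {φ : ℝ → ℝ} (hφ : Measurable φ) (x : ℝ) :
    ∫ ω in {ω | X ω ≤ x}, φ (P.real {ω' | X ω' ≤ X ω}) ∂P =
      ∫ u in (0 : ℝ)..P.real {ω | X ω ≤ x}, φ u := by
  rw [setIntegral_congr_set (setOf_le_ae_eq_distribution hX hc x),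
    intervalIntegral.integral_of_le measureReal_nonneg,
    ← setIntegral_map measurableSet_Iic hφ.aestronglyMeasurable
      (measurable_distribution hX).aemeasurable,
    map_distribution_eq_uniform hX hc, Measure.restrict_restrict measurableSet_Iic, Iic_inter_Ioc_zero_one,
    min_eq_left measureReal_le_one]

end DistributionFunction

/-! ### Chatterjee's coefficient as an integral of the squared partial derivative -/

/-- `k` is a measurable version of the partial derivative `∂₁ C` of a copula `C`. -/
structure IsCopulaDensity (C k : ℝ → ℝ → ℝ) : Prop where
  measurable : Measurable (Function.uncurry k)
  nonneg : ∀ u v, 0 ≤ k u v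
  le_one : ∀ u v, k u v ≤ 1
  one_left : ∀ v ∈ Icc (0 : ℝ) 1, C 1 v = v
  integral_eq : ∀ b ∈ Icc (0 : ℝ) 1, ∀ v ∈ Icc (0 : ℝ) 1, ∫ u in (0 : ℝ)..b, k u v = C b v

namespace IsCopulaDensity

variable {C k : ℝ → ℝ → ℝ} {Ω : Type*} [MeasurableSpace Ω] {P : Measure Ω}
  [IsProbabilityMeasure P] {X Y : Ω → ℝ}

lemma measurable_left (hk : IsCopulaDensity C k) (v : ℝ) : Measurable fun u => k u v :=
  hk.measurable.comp (measurable_id.prodMk measurable_const)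

lemma integrable_comp (hk : IsCopulaDensity C k) {U : Ω → ℝ} (hU : Measurable U) (v : ℝ) :
    Integrable (fun ω => k (U ω) v) P :=
  Integrable.of_bound ((hk.measurable_left v).comp hU).aestronglyMeasurable 1
    (.of_forall fun _ => by
      rw [Real.norm_eq_abs, abs_of_nonneg (hk.nonneg _ _)]
      exact hk.le_one _ _)

/-- The conditional distribution function of `Y` given `X` is `∂₁ C (F X) (G y)`. -/
theorem condExp_indicator_le (hk : IsCopulaDensity C k) (h : HasCopula P X Y C) (y : ℝ) :
    (fun ω => k (P.real {ω' | X ω' ≤ X ω}) (P.real {ω | Y ω ≤ y})) =ᵐ[P]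
      condExp (MeasurableSpace.comap X inferInstance) P
        ({ω | Y ω ≤ y}.indicator fun _ => (1 : ℝ)) := by
  have hX := h.measurable_fst
  have hY : MeasurableSet {ω | Y ω ≤ y} := h.measurable_snd measurableSet_Iic
  set v := P.real {ω | Y ω ≤ y} with hv
  have hvI : v ∈ Icc (0 : ℝ) 1 := ⟨measureReal_nonneg, measureReal_le_one⟩
  set κ : Ω → ℝ := fun ω => k (P.real {ω' | X ω' ≤ X ω}) v with hκ
  have hκm : Measurable κ := (hk.measurable_left v).comp (measurable_distribution hX)
  have hκi : Integrable κ P := hk.integrable_comp (measurable_distribution hX) v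
  have hset : ∀ s, MeasurableSet s →
      ∫⁻ ω in s, ENNReal.ofReal (κ ω) ∂P = ENNReal.ofReal (∫ ω in s, κ ω ∂P) := fun s _ =>
    (ofReal_integral_eq_lintegral_ofReal hκi.restrict
      (.of_forall fun _ => hk.nonneg _ _)).symm
  -- It suffices to compare both finite measures on half-lines, where the joint distribution
  -- function decides. Equality on all Borel sets `B` is then the defining identity of the
  -- conditional expectation on the events `X ∈ B`.
  have hmeas : (P.restrict {ω | Y ω ≤ y}).map X =
      (P.withDensity fun ω => ENNReal.ofReal (κ ω)).map X := by
    refine Measure.ext_of_Iic _ _ fun x => ?_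
    have hXx : MeasurableSet (X ⁻¹' Iic x) := hX measurableSet_Iic
    rw [Measure.map_apply hX measurableSet_Iic, Measure.map_apply hX measurableSet_Iic,
      Measure.restrict_apply hXx, withDensity_apply _ hXx, hset _ hXx]
    have := setIntegral_comp_distribution hX h.continuous_fst (hk.measurable_left v) x
    have h2 := h.joint x y
    rw [← hv, ← hk.integral_eq _ ⟨measureReal_nonneg, measureReal_le_one⟩ v hvI, ← this] at h2
    change P {ω | X ω ≤ x ∧ Y ω ≤ y} = ENNReal.ofReal (∫ ω in {ω | X ω ≤ x}, κ ω ∂P)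
    rw [← h2, ofReal_measureReal]
  refine ae_eq_condExp_of_forall_setIntegral_eq hX.comap_le
    ((integrable_const _).indicator hY) (fun _ _ _ => hκi.integrableOn) ?_ ?_
  · rintro _ ⟨B, hB, rfl⟩ _
    have h1 := congrArg (fun ν : Measure ℝ => ν.real B) hmeas
    rw [setIntegral_indicator hY, setIntegral_const, smul_eq_mul, mul_one]
    simp only [measureReal_def] at h1 ⊢
    rw [Measure.map_apply hX hB, Measure.map_apply hX hB, Measure.restrict_apply (hX hB),
      withDensity_apply _ (hX hB), hset _ (hX hB), ENNReal.toReal_ofReal] at h1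
    · exact h1.symm
    · exact integral_nonneg fun _ => hk.nonneg _ _
  · refine StronglyMeasurable.aestronglyMeasurable (Measurable.stronglyMeasurable ?_)
    exact ((hk.measurable_left v).comp
      (monotone_measureReal_le (P := P) (X := X)).measurable).comp (comap_measurable X)

/-- `Y` has no atoms, so `{Y ≥ y}` and `{Y ≤ y}` are complementary up to a null set. -/
lemma indicator_ge_ae_eq (h : HasCopula P X Y C) (y : ℝ) :
    {ω | y ≤ Y ω}.indicator (fun _ => (1 : ℝ)) =ᵐ[P]
      (fun _ => 1) - {ω | Y ω ≤ y}.indicator (fun _ => (1 : ℝ)) := by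
  have h0 : ∀ᵐ ω ∂P, Y ω ≠ y := by
    simpa [ae_iff] using measure_eq_zero_of_continuous h.measurable_snd h.continuous_snd y
  filter_upwards [h0] with ω hω
  rcases lt_or_gt_of_ne hω with hlt | hlt <;>
    simp [indicator, hlt.le, hlt.not_ge]

lemma condExp_indicator_ge (hk : IsCopulaDensity C k) (h : HasCopula P X Y C) (y : ℝ) :
    condExp (MeasurableSpace.comap X inferInstance) P
        ({ω | y ≤ Y ω}.indicator fun _ => (1 : ℝ)) =ᵐ[P]
      (fun ω => 1 - k (P.real {ω' | X ω' ≤ X ω}) (P.real {ω | Y ω ≤ y})) := by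
  have hY : MeasurableSet {ω | Y ω ≤ y} := h.measurable_snd measurableSet_Iic
  refine (condExp_congr_ae (indicator_ge_ae_eq h y)).trans ?_
  refine (condExp_sub (integrable_const _) ((integrable_const _).indicator hY) _).trans ?_
  rw [condExp_const h.measurable_fst.comap_le]
  filter_upwards [hk.condExp_indicator_le h y] with ω hω
  rw [Pi.sub_apply, ← hω]

lemma variance_one_sub {Z : Ω → ℝ} (hZ : Measurable Z) (h0 : ∀ ω, 0 ≤ Z ω) (h1 : ∀ ω, Z ω ≤ 1) :
    variance (fun ω => 1 - Z ω) P = ∫ ω, Z ω ^ 2 ∂P - (∫ ω, Z ω ∂P) ^ 2 := by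
  have hm : MemLp Z 2 P := MemLp.of_bound hZ.aestronglyMeasurable 1 (.of_forall fun ω => by
    rw [Real.norm_eq_abs, abs_of_nonneg (h0 ω)]
    exact h1 ω)
  rw [variance_const_sub hZ.aestronglyMeasurable, variance_eq_sub hm]
  rfl

lemma variance_condExp (hk : IsCopulaDensity C k) (h : HasCopula P X Y C) (y : ℝ) :
    variance (condExp (MeasurableSpace.comap X inferInstance) P
        ({ω | y ≤ Y ω}.indicator fun _ => (1 : ℝ))) P =
      (∫ u in Ioc (0 : ℝ) 1, k u (P.real {ω | Y ω ≤ y}) ^ 2) - P.real {ω | Y ω ≤ y} ^ 2 := by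
  have hX := h.measurable_fst
  have hvI : P.real {ω | Y ω ≤ y} ∈ Icc (0 : ℝ) 1 := ⟨measureReal_nonneg, measureReal_le_one⟩
  rw [variance_congr (hk.condExp_indicator_ge h y),
    variance_one_sub (Z := fun ω => k (P.real {ω' | X ω' ≤ X ω}) (P.real {ω | Y ω ≤ y}))
      ((hk.measurable_left _).comp (measurable_distribution hX))
      (fun _ => hk.nonneg _ _) (fun _ => hk.le_one _ _),
    integral_comp_distribution hX h.continuous_fst (hk.measurable_left _),
    integral_comp_distribution hX h.continuous_fst (φ := fun u => k u _ ^ 2)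
      ((hk.measurable_left _).pow_const 2),
    ← intervalIntegral.integral_of_le (f := fun u => k u _) zero_le_one,
    hk.integral_eq 1 (by simp) _ hvI, hk.one_left _ hvI]

lemma variance_indicator (h : HasCopula P X Y C) (y : ℝ) :
    variance ({ω | y ≤ Y ω}.indicator fun _ => (1 : ℝ)) P =
      P.real {ω | Y ω ≤ y} - P.real {ω | Y ω ≤ y} ^ 2 := by
  have hY : MeasurableSet {ω | Y ω ≤ y} := h.measurable_snd measurableSet_Iic
  rw [variance_congr (indicator_ge_ae_eq h y)]
  have hsq : ∀ ω, {ω | Y ω ≤ y}.indicator (fun _ => (1 : ℝ)) ω ^ 2 =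
      {ω | Y ω ≤ y}.indicator (fun _ => (1 : ℝ)) ω := fun ω => by
    by_cases hω : Y ω ≤ y <;> simp [indicator, hω]
  refine (variance_one_sub (measurable_const.indicator hY) ?_ ?_).trans ?_
  · exact fun ω => indicator_nonneg (fun _ _ => zero_le_one) ω
  · exact fun ω => indicator_le_self' (fun _ _ => zero_le_one) ω
  · simp only [hsq, integral_indicator_const _ hY, smul_eq_mul, mul_one]

/-- With `v = G(y)` uniform, the numerator is `∫∫ k² - 1/3`, because `k(·, v)` has mean `C 1 v = v`,
and the denominator is `1/2 - 1/3 = 1/6`. -/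
theorem chatterjeeXi_eq (hk : IsCopulaDensity C k) (h : HasCopula P X Y C) :
    chatterjeeXi P X Y =
      6 * (∫ v in Ioc (0 : ℝ) 1, ∫ u in Ioc (0 : ℝ) 1, k u v ^ 2) - 2 := by
  have hY := h.measurable_snd
  have hm : StronglyMeasurable fun v => ∫ u in Ioc (0 : ℝ) 1, k u v ^ 2 :=
    (hk.measurable.pow_const 2).stronglyMeasurable.integral_prod_left
      (f := fun u v => k u v ^ 2)
  have hb : ∀ v, ‖∫ u in Ioc (0 : ℝ) 1, k u v ^ 2‖ ≤ 1 := fun v => by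
    refine (norm_setIntegral_le_of_norm_le_const (C := 1) (by simp) fun u _ => ?_).trans (by simp)
    rw [norm_pow, Real.norm_eq_abs, abs_of_nonneg (hk.nonneg _ _)]
    exact pow_le_one₀ (hk.nonneg _ _) (hk.le_one _ _)
  have h2 : ∫ v in Ioc (0 : ℝ) 1, v ^ 2 = 1 / 3 := by
    rw [← intervalIntegral.integral_of_le zero_le_one, integral_pow]
    norm_num
  have h1 : ∫ v in Ioc (0 : ℝ) 1, v = 1 / 2 := by
    rw [← intervalIntegral.integral_of_le zero_le_one, integral_id]
    norm_num
  have hint : ∀ n : ℕ, IntegrableOn (fun v : ℝ => v ^ n) (Ioc 0 1) := fun n =>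
    ((continuous_pow n).integrableOn_Icc).mono_set Ioc_subset_Icc_self
  rw [chatterjeeXi]
  simp only [hk.variance_condExp h, variance_indicator h]
  rw [integral_map_comp_distribution hY h.continuous_snd
      (φ := fun v => (∫ u in Ioc (0 : ℝ) 1, k u v ^ 2) - v ^ 2)
      (hm.measurable.sub (measurable_id.pow_const 2)),
    integral_map_comp_distribution hY h.continuous_snd (φ := fun v => v - v ^ 2)
      (measurable_id.sub (measurable_id.pow_const 2)),
    integral_sub (Integrable.of_bound hm.aestronglyMeasurable 1 (.of_forall hb)) (hint 2),
    integral_sub (by simpa [IntegrableOn] using hint 1) (hint 2), h1, h2]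
  ring

end IsCopulaDensity

/-! ### Folding integrals over the unit square -/

lemma integrableOn_Ioc_of_abs_le_one {φ : ℝ → ℝ} (hφ : Measurable φ)
    (h : ∀ u ∈ Ioc (0 : ℝ) 1, |φ u| ≤ 1) : IntegrableOn φ (Ioc 0 1) :=
  Integrable.of_bound hφ.aestronglyMeasurable 1
    ((ae_restrict_iff' measurableSet_Ioc).2 (.of_forall h))

lemma integrable_unitSquare_of_abs_le_one {φ : ℝ → ℝ → ℝ} (hφ : Measurable (Function.uncurry φ))
    (h : ∀ u ∈ Ioc (0 : ℝ) 1, ∀ v ∈ Ioc (0 : ℝ) 1, |φ u v| ≤ 1) :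
    Integrable (Function.uncurry φ)
      ((volume.restrict (Ioc (0 : ℝ) 1)).prod (volume.restrict (Ioc (0 : ℝ) 1))) := by
  refine Integrable.of_bound hφ.aestronglyMeasurable 1 ?_
  rw [Measure.prod_restrict]
  exact (ae_restrict_iff' (measurableSet_Ioc.prod measurableSet_Ioc)).2
    (.of_forall fun x hx => h x.1 hx.1 x.2 hx.2)

/-- An integral over the unit square, folded along the diagonal. -/
theorem integral_unitSquare_fold {p q : ℝ → ℝ → ℝ} (hp : Measurable (Function.uncurry p))
    (hq : Measurable (Function.uncurry q))
    (hp1 : ∀ u v, 0 < v → v ≤ u → u ≤ 1 → |p u v| ≤ 1)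
    (hq1 : ∀ u v, 0 < v → v ≤ u → u ≤ 1 → |q u v| ≤ 1) :
    ∫ u in Ioc (0 : ℝ) 1, ∫ v in Ioc (0 : ℝ) 1, (if v ≤ u then p u v else q v u) =
      ∫ u in Ioc (0 : ℝ) 1, ((∫ v in Ioc 0 u, p u v) + ∫ v in Ioc 0 u, q u v) := by
  set A : ℝ → ℝ → ℝ := fun u v => if v ≤ u then p u v else 0 with hA
  set B : ℝ → ℝ → ℝ := fun u v => if v ≤ u then 0 else q v u with hB
  have hle : MeasurableSet {x : ℝ × ℝ | x.2 ≤ x.1} := measurableSet_le measurable_snd measurable_fst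
  have hAm : Measurable (Function.uncurry A) := Measurable.ite hle hp measurable_const
  have hBm : Measurable (Function.uncurry B) :=
    Measurable.ite hle measurable_const (hq.comp measurable_swap)
  have hAi := integrable_unitSquare_of_abs_le_one hAm fun u hu v hv => by
    simp only [hA]
    split_ifs with h
    · exact hp1 u v hv.1 h hu.2
    · simp
  have hBi := integrable_unitSquare_of_abs_le_one hBm fun u hu v hv => by
    simp only [hB]
    split_ifs with h
    · simp
    · exact hq1 v u hu.1 (not_le.1 h).le hv.2
  have hAB : ∀ u v, (if v ≤ u then p u v else q v u) = A u v + B u v := fun u v => by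
    simp only [hA, hB]
    split_ifs <;> simp
  have hAin : ∀ u ∈ Ioc (0 : ℝ) 1, ∫ v in Ioc (0 : ℝ) 1, A u v = ∫ v in Ioc 0 u, p u v := by
    intro u hu
    have : ∀ v, A u v = (Iic u).indicator (p u) v := fun v => by
      simp [hA, indicator]
    simp only [this]
    rw [setIntegral_indicator measurableSet_Iic, inter_comm, Iic_inter_Ioc_zero_one,
      min_eq_left hu.2]
  have hBin : ∀ v ∈ Ioc (0 : ℝ) 1, ∫ u in Ioc (0 : ℝ) 1, B u v = ∫ u in Ioc 0 v, q v u := by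
    intro v hv
    have : ∀ u, B u v = (Iio v).indicator (q v) u := fun u => by
      by_cases h : v ≤ u
      · simp [hB, indicator, h, not_lt.2 h]
      · simp [hB, indicator, h, not_le.1 h]
    simp only [this]
    rw [setIntegral_indicator measurableSet_Iio]
    have hs : Ioc 0 1 ∩ Iio v = Ioo 0 v := by
      ext x
      simp only [mem_inter_iff, mem_Ioc, mem_Iio, mem_Ioo]
      exact ⟨fun h => ⟨h.1.1, h.2⟩, fun h => ⟨⟨h.1, h.2.le.trans hv.2⟩, h.2⟩⟩
    rw [hs, integral_Ioc_eq_integral_Ioo]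
  calc ∫ u in Ioc (0 : ℝ) 1, ∫ v in Ioc (0 : ℝ) 1, (if v ≤ u then p u v else q v u)
      = ∫ u in Ioc (0 : ℝ) 1, ∫ v in Ioc (0 : ℝ) 1, (A u v + B u v) := by simp only [hAB]
    _ = (∫ u in Ioc (0 : ℝ) 1, ∫ v in Ioc (0 : ℝ) 1, A u v) +
          ∫ u in Ioc (0 : ℝ) 1, ∫ v in Ioc (0 : ℝ) 1, B u v := integral_integral_add hAi hBi
    -- Fubini on the part above the diagonal makes the larger coordinate the outer variable in both
    -- terms.
    _ = (∫ u in Ioc (0 : ℝ) 1, ∫ v in Ioc (0 : ℝ) 1, A u v) +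
          ∫ v in Ioc (0 : ℝ) 1, ∫ u in Ioc (0 : ℝ) 1, B u v := by
        rw [integral_integral_swap hBi]
    _ = ∫ u in Ioc (0 : ℝ) 1, ((∫ v in Ioc (0 : ℝ) 1, A u v) + ∫ v in Ioc (0 : ℝ) 1, B v u) :=
        (integral_add hAi.integral_prod_left hBi.integral_prod_right).symm
    _ = _ := setIntegral_congr_fun measurableSet_Ioc fun u hu => by
        simp only [hAin u hu, hBin u hu]

/-! ### The gap between Spearman's and Chatterjee's coefficients -/

/-- The partial derivative in `u` of the lower semilinear copula with ratio `f` and slope `g`. -/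
noncomputable def semilinearDensity (f g : ℝ → ℝ) (u v : ℝ) : ℝ :=
  if 0 < v ∧ v < u then v * g u else f v

namespace IsSemilinearSlope

variable {f g : ℝ → ℝ}

lemma mul_slope_le_one (h : IsSemilinearSlope f g) {u : ℝ} (hu : u ∈ Ioc (0 : ℝ) 1) :
    u * g u ≤ 1 :=
  (h.mul_slope_le u hu).trans (h.ratio_le_one u)

lemma mul_slope_nonneg (h : IsSemilinearSlope f g) {u : ℝ} (hu : u ∈ Ioc (0 : ℝ) 1) :
    0 ≤ u * g u :=
  mul_nonneg hu.1.le (h.slope_nonneg u)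

lemma mul_slope_le_one_of_le (h : IsSemilinearSlope f g) {u v : ℝ} (hvu : v ≤ u) (hu : 0 < u) :
    v * g u ≤ 1 := by
  by_cases hu1 : u ≤ 1
  · exact (mul_le_mul_of_nonneg_right hvu (h.slope_nonneg u)).trans (h.mul_slope_le_one ⟨hu, hu1⟩)
  · rw [h.slope_of_notMem u fun hu' => hu1 hu'.2, mul_zero]
    exact zero_le_one

lemma monotoneOn_ratio (h : IsSemilinearSlope f g) {a b : ℝ} (ha : 0 < a) (hab : a ≤ b)
    (hb : b ≤ 1) : f a ≤ f b := by
  rw [← sub_nonneg, ← h.integral_slope a b ha hab hb]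
  exact intervalIntegral.integral_nonneg hab fun u _ => h.slope_nonneg u

/-- For `0 < v ≤ b`, the range up to `v` contributes `v f(v)` and the rest `v (f(b) - f(v))`, which
telescopes to `v f(b)`. -/
lemma integral_semilinearDensity (h : IsSemilinearSlope f g) {b v : ℝ} (hb : b ∈ Icc (0 : ℝ) 1)
    (hv : v ∈ Icc (0 : ℝ) 1) :
    ∫ u in (0 : ℝ)..b, semilinearDensity f g u v = min b v * f (max b v) := by
  have hleft : ∀ c : ℝ, c ≤ v → EqOn (fun u => semilinearDensity f g u v) (fun _ => f v) (Iic c) :=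
    fun c hc u hu => if_neg fun h' => absurd h'.2 (not_lt.2 (le_trans hu hc))
  have hleftc : ∀ c : ℝ, 0 ≤ c → c ≤ v →
      EqOn (fun u => semilinearDensity f g u v) (fun _ => f v) (uIcc 0 c) :=
    fun c h0 hc => (hleft c hc).mono (by rw [uIcc_of_le h0]; exact Icc_subset_Iic_self)
  rcases le_total b v with hbv | hvb
  · rw [min_eq_left hbv, max_eq_right hbv, intervalIntegral.integral_congr (hleftc b hb.1 hbv)]
    simp
  rw [min_eq_right hvb, max_eq_left hvb]
  rcases hv.1.eq_or_lt with rfl | hv0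
  · rw [zero_mul]
    have : ∀ u, semilinearDensity f g u 0 = 0 := fun u => by
      simp [semilinearDensity, h.ratio_of_notMem]
    simp [this]
  have hright : EqOn (fun u => v * g u) (fun u => semilinearDensity f g u v) (uIoc v b) := by
    rw [uIoc_of_le hvb]
    exact fun u hu => (if_pos ⟨hv0, hu.1⟩).symm
  have hi := (h.intervalIntegrable v b hv0 hvb hb.2).const_mul v
  rw [← intervalIntegral.integral_add_adjacent_intervals
      (intervalIntegrable_const.congr fun u hu =>
        (hleftc v hv.1 le_rfl (uIoc_subset_uIcc hu)).symm) (hi.congr hright),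
    intervalIntegral.integral_congr (hleftc v hv.1 le_rfl),
    ← intervalIntegral.integral_congr_ae (.of_forall hright), intervalIntegral.integral_const_mul,
    h.integral_slope v b hv0 hvb hb.2, intervalIntegral.integral_const, smul_eq_mul]
  ring

theorem isCopulaDensity (h : IsSemilinearSlope f g) {C : ℝ → ℝ → ℝ}
    (hC : ∀ u ∈ Icc (0 : ℝ) 1, ∀ v ∈ Icc (0 : ℝ) 1, C u v = min u v * f (max u v)) :
    IsCopulaDensity C (semilinearDensity f g) where
  measurable := by
    refine Measurable.ite ?_ (measurable_snd.mul (h.measurable_slope.comp measurable_fst))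
      (h.measurable_ratio.comp measurable_snd)
    exact (measurableSet_lt measurable_const measurable_snd).inter
      (measurableSet_lt measurable_snd measurable_fst)
  nonneg u v := by
    rw [semilinearDensity]
    split_ifs with hv
    · exact mul_nonneg hv.1.le (h.slope_nonneg u)
    · exact h.ratio_nonneg v
  le_one u v := by
    rw [semilinearDensity]
    split_ifs with hv
    · exact h.mul_slope_le_one_of_le hv.2.le (hv.1.trans hv.2)
    · exact h.ratio_le_one v
  one_left v hv := by
    rw [hC 1 (by simp) v hv, min_eq_right hv.2, max_eq_left hv.2, h.ratio_one, mul_one]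
  integral_eq b hb v hv := by rw [h.integral_semilinearDensity hb hv, hC b hb v hv]

/-- When the larger coordinate is `u`, the smaller one runs over `(0,u]`: one triangle yields `u
f²`, the other `g² ∫ v² = u³ g² / 3`. -/
lemma integral_semilinearDensity_sq (h : IsSemilinearSlope f g) :
    ∫ v in Ioc (0 : ℝ) 1, ∫ u in Ioc (0 : ℝ) 1, semilinearDensity f g u v ^ 2 =
      ∫ u in Ioc (0 : ℝ) 1, (u * f u ^ 2 + u ^ 3 * g u ^ 2 / 3) := by
  have heq : ∫ v in Ioc (0 : ℝ) 1, ∫ u in Ioc (0 : ℝ) 1, semilinearDensity f g u v ^ 2 =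
      ∫ v in Ioc (0 : ℝ) 1, ∫ u in Ioc (0 : ℝ) 1,
        (if u ≤ v then f v ^ 2 else (v * g u) ^ 2) := by
    refine setIntegral_congr_fun measurableSet_Ioc fun v hv => ?_
    refine integral_congr_ae (.of_forall fun u => ?_)
    by_cases huv : u ≤ v
    · simp [semilinearDensity, huv, not_lt.2 huv]
    · simp [semilinearDensity, huv, not_le.1 huv, hv.1]
  rw [heq, integral_unitSquare_fold (p := fun u _ => f u ^ 2) (q := fun u v => (v * g u) ^ 2)
    ((h.measurable_ratio.comp measurable_fst).pow_const 2)
    ((measurable_snd.mul (h.measurable_slope.comp measurable_fst)).pow_const 2)]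
  · refine setIntegral_congr_fun measurableSet_Ioc fun u hu => ?_
    simp only [mul_pow]
    rw [← intervalIntegral.integral_of_le hu.1.le, ← intervalIntegral.integral_of_le hu.1.le,
      intervalIntegral.integral_const, intervalIntegral.integral_mul_const, integral_pow]
    simp only [smul_eq_mul]
    norm_num
    ring
  · intro u v _ _ _
    rw [abs_of_nonneg (sq_nonneg _)]
    exact pow_le_one₀ (h.ratio_nonneg u) (h.ratio_le_one u)
  · intro u v hv hvu hu
    rw [abs_of_nonneg (sq_nonneg _)]
    exact pow_le_one₀ (mul_nonneg hv.le (h.slope_nonneg u))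
      (h.mul_slope_le_one_of_le hvu (hv.trans_le hvu))

theorem spearmanRho_eq (h : IsSemilinearSlope f g) {C : ℝ → ℝ → ℝ}
    (hC : ∀ u ∈ Icc (0 : ℝ) 1, ∀ v ∈ Icc (0 : ℝ) 1, C u v = min u v * f (max u v)) :
    spearmanRho C = 12 * (∫ u in Ioc (0 : ℝ) 1, u ^ 2 * f u) - 3 := by
  have heq : ∫ u in Icc (0 : ℝ) 1, ∫ v in Icc (0 : ℝ) 1, C u v =
      ∫ u in Ioc (0 : ℝ) 1, ∫ v in Ioc (0 : ℝ) 1, (if v ≤ u then v * f u else u * f v) := by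
    simp only [integral_Icc_eq_integral_Ioc]
    refine setIntegral_congr_fun measurableSet_Ioc fun u hu => ?_
    refine setIntegral_congr_fun measurableSet_Ioc fun v hv => ?_
    simp only [hC u (Ioc_subset_Icc_self hu) v (Ioc_subset_Icc_self hv)]
    split_ifs with hvu
    · rw [min_eq_right hvu, max_eq_left hvu]
    · rw [min_eq_left (not_le.1 hvu).le, max_eq_right (not_le.1 hvu).le]
  have hm : Measurable (Function.uncurry fun u v : ℝ => v * f u) :=
    measurable_snd.mul (h.measurable_ratio.comp measurable_fst)
  have hb : ∀ u v : ℝ, 0 < v → v ≤ u → u ≤ 1 → |v * f u| ≤ 1 := fun u v hv hvu hu => by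
    rw [abs_of_nonneg (mul_nonneg hv.le (h.ratio_nonneg u))]
    exact mul_le_one₀ (hvu.trans hu) (h.ratio_nonneg u) (h.ratio_le_one u)
  rw [spearmanRho, heq, integral_unitSquare_fold (p := fun u v => v * f u)
    (q := fun u v => v * f u) hm hm hb hb]
  congr 2
  refine setIntegral_congr_fun measurableSet_Ioc fun u hu => ?_
  rw [← intervalIntegral.integral_of_le hu.1.le, intervalIntegral.integral_mul_const, integral_id]
  ring

theorem spearmanRho_sub_chatterjeeXi (h : IsSemilinearSlope f g) {C : ℝ → ℝ → ℝ}
    (hC : ∀ u ∈ Icc (0 : ℝ) 1, ∀ v ∈ Icc (0 : ℝ) 1, C u v = min u v * f (max u v))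
    {Ω : Type*} [MeasurableSpace Ω] {P : Measure Ω} [IsProbabilityMeasure P] {X Y : Ω → ℝ}
    (hXY : HasCopula P X Y C) :
    spearmanRho C - chatterjeeXi P X Y =
      ∫ u in Ioc (0 : ℝ) 1, 2 * (u ^ 2 * g u) * (3 * f u - 2 * u - u * g u) := by
  have hf := h.measurable_ratio
  have hg := h.measurable_slope
  -- `g` may be unbounded near 0, but `u g ≤ f ≤ 1`; all integrands are therefore written as
  -- monomials in `u`, `f` and `u g`.
  have bound : ∀ u ∈ Ioc (0 : ℝ) 1, ∀ i j l : ℕ, |u ^ i * f u ^ j * (u * g u) ^ l| ≤ 1 := by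
    intro u hu i j l
    have h1 := pow_nonneg (h.ratio_nonneg u) j
    have h2 := pow_nonneg (h.mul_slope_nonneg hu) l
    have h3 := pow_nonneg hu.1.le i
    rw [abs_of_nonneg (by positivity)]
    exact mul_le_one₀ (mul_le_one₀ (pow_le_one₀ hu.1.le hu.2) h1
      (pow_le_one₀ (h.ratio_nonneg u) (h.ratio_le_one u))) h2
      (pow_le_one₀ (h.mul_slope_nonneg hu) (h.mul_slope_le_one hu))
  have int : ∀ i j l : ℕ, IntegrableOn (fun u => u ^ i * f u ^ j * (u * g u) ^ l) (Ioc 0 1) :=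
    fun i j l => integrableOn_Ioc_of_abs_le_one (by fun_prop) fun u hu => bound u hu i j l
  have i1 : IntegrableOn (fun u => u ^ 2 * f u) (Ioc 0 1) := by simpa using int 2 1 0
  have i2 : IntegrableOn (fun u => u ^ 3 * g u) (Ioc 0 1) :=
    (int 2 0 1).congr_fun (fun u _ => by ring) measurableSet_Ioc
  have i3 : IntegrableOn (fun u => u * f u ^ 2) (Ioc 0 1) := by simpa using int 1 2 0
  have i4 : IntegrableOn (fun u => u ^ 2 * (f u * g u)) (Ioc 0 1) :=
    (int 1 1 1).congr_fun (fun u _ => by ring) measurableSet_Ioc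
  have i5 : IntegrableOn (fun u => u ^ 3 * g u ^ 2) (Ioc 0 1) :=
    (int 1 0 2).congr_fun (fun u _ => by ring) measurableSet_Ioc
  have j2 : IntegrableOn (fun u => 12 * (u ^ 2 * f u) + 4 * (u ^ 3 * g u)) (Ioc 0 1) :=
    (i1.const_mul 12).add (i2.const_mul 4)
  have j3 : IntegrableOn
      (fun u => 12 * (u ^ 2 * f u) + 4 * (u ^ 3 * g u) - 6 * (u * f u ^ 2)) (Ioc 0 1) :=
    j2.sub (i3.const_mul 6)
  have j4 : IntegrableOn (fun u => 6 * (u ^ 2 * (f u * g u)) - 4 * (u ^ 3 * g u)) (Ioc 0 1) :=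
    (i4.const_mul 6).sub (i2.const_mul 4)
  have hpot := h.integral_potential
  rw [intervalIntegral.integral_of_le zero_le_one,
    integral_sub j3 (i4.const_mul 6),
    integral_sub j2 (i3.const_mul 6),
    integral_add (i1.const_mul 12) (i2.const_mul 4)] at hpot
  simp only [integral_const_mul] at hpot
  have hxi := (h.isCopulaDensity hC).chatterjeeXi_eq hXY
  rw [h.integral_semilinearDensity_sq, integral_add i3 (i5.div_const 3), integral_div] at hxi
  have hgap : ∫ u in Ioc (0 : ℝ) 1, 2 * (u ^ 2 * g u) * (3 * f u - 2 * u - u * g u) =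
      ∫ u in Ioc (0 : ℝ) 1,
        (6 * (u ^ 2 * (f u * g u)) - 4 * (u ^ 3 * g u) - 2 * (u ^ 3 * g u ^ 2)) :=
    integral_congr_ae (.of_forall fun u => by ring)
  rw [hgap, integral_sub j4 (i5.const_mul 2),
    integral_sub (i4.const_mul 6) (i2.const_mul 4), hxi, h.spearmanRho_eq hC]
  simp only [integral_const_mul]
  linarith

theorem chatterjeeXi_le_spearmanRho (h : IsSemilinearSlope f g) {C : ℝ → ℝ → ℝ}
    (hC : ∀ u ∈ Icc (0 : ℝ) 1, ∀ v ∈ Icc (0 : ℝ) 1, C u v = min u v * f (max u v))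
    {Ω : Type*} [MeasurableSpace Ω] {P : Measure Ω} [IsProbabilityMeasure P] {X Y : Ω → ℝ}
    (hXY : HasCopula P X Y C) :
    chatterjeeXi P X Y ≤ spearmanRho C := by
  rw [← sub_nonneg, h.spearmanRho_sub_chatterjeeXi hC hXY]
  refine setIntegral_nonneg measurableSet_Ioc fun u hu => ?_
  -- The last factor is `2 (f - u) + (f - u g)`, a sum of nonnegative terms.
  have h1 := h.mul_slope_le u hu
  have h2 := h.self_le_ratio u hu
  exact mul_nonneg (mul_nonneg zero_le_two (mul_nonneg (sq_nonneg u) (h.slope_nonneg u)))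
    (by linarith)

end IsSemilinearSlope

/-! ### Existence of a pair with the given copula -/

lemma IsLSLDiagonal.lslCopula_eq {δ : ℝ → ℝ} {u : ℝ} (hu : u ∈ Icc (0 : ℝ) 1) {v : ℝ}
    (hv : v ∈ Icc (0 : ℝ) 1) :
    lslCopula δ u v = min u v * diagRatio δ (max u v) := by
  have hr : ∀ t ∈ Icc (0 : ℝ) 1, diagRatio δ t = δ t / t := fun t ht => by
    rcases ht.1.eq_or_lt with rfl | h0
    -- At 0 both sides vanish, since division by zero returns 0.
    · simp [diagRatio]
    · exact diagRatio_eq ⟨h0, ht.2⟩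
  rw [lslCopula]
  split_ifs with hvu
  · rw [min_eq_right hvu, max_eq_left hvu, hr u hu]
  · rw [min_eq_left (not_le.1 hvu).le, max_eq_right (not_le.1 hvu).le, hr v hv]

/-- The law on the unit square with density `g (max u v)`, plus a singular part on the diagonal
with density `f u - u * g u`. -/
noncomputable def semilinearMeasure (f g : ℝ → ℝ) : Measure (ℝ × ℝ) :=
  ((volume.restrict (Ioc (0 : ℝ) 1)).prod (volume.restrict (Ioc (0 : ℝ) 1))).withDensity
      (fun x => ENNReal.ofReal (g (max x.1 x.2))) +
    ((volume.restrict (Ioc (0 : ℝ) 1)).withDensity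
      (fun u => ENNReal.ofReal (f u - u * g u))).map (fun u => (u, u))

namespace IsSemilinearSlope

variable {f g : ℝ → ℝ}

/-- Only the traces of `A` and `B` on `(0,1]` matter, so half-lines and the whole line are treated
together; the latter gives the marginals. -/
lemma semilinearMeasure_prod_eq_add (h : IsSemilinearSlope f g) {A B : Set ℝ}
    (hA : MeasurableSet A) (hB : MeasurableSet B) {a b : ℝ} (ha : A ∩ Ioc 0 1 = Ioc 0 a)
    (hb : B ∩ Ioc 0 1 = Ioc 0 b) :
    semilinearMeasure f g (A ×ˢ B) =
      (∫⁻ u in Ioc 0 a, ∫⁻ v in Ioc 0 b, ENNReal.ofReal (g (max u v))) +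
        ∫⁻ u in Ioc 0 (min a b), ENNReal.ofReal (f u - u * g u) := by
  have hdiag : (fun u : ℝ => (u, u)) ⁻¹' (A ×ˢ B) = A ∩ B := by ext; simp
  have hm : Measurable fun u : ℝ => (u, u) := measurable_id.prodMk measurable_id
  have hg : Measurable fun x : ℝ × ℝ => ENNReal.ofReal (g (max x.1 x.2)) :=
    (h.measurable_slope.comp (measurable_fst.max measurable_snd)).ennreal_ofReal
  have hmin : A ∩ B ∩ Ioc 0 1 = Ioc 0 (min a b) := by
    rw [inter_inter_distrib_right, ha, hb, Ioc_inter_Ioc, max_self]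
  rw [semilinearMeasure, Measure.add_apply, Measure.map_apply hm (hA.prod hB), hdiag,
    withDensity_apply _ (hA.prod hB), withDensity_apply _ (hA.inter hB), ← Measure.prod_restrict,
    Measure.restrict_restrict hA, Measure.restrict_restrict hB,
    Measure.restrict_restrict (hA.inter hB), ha, hb, hmin, lintegral_prod _ hg.aemeasurable]

lemma lintegral_slope_max (h : IsSemilinearSlope f g) {u b : ℝ} (hu : 0 < u) (hub : u ≤ b)
    (hb : b ≤ 1) :
    ∫⁻ v in Ioc 0 b, ENNReal.ofReal (g (max u v)) =
      ENNReal.ofReal (u * g u + (f b - f u)) := by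
  have h1 : ∫⁻ v in Ioc 0 u, ENNReal.ofReal (g (max u v)) = ENNReal.ofReal (u * g u) := by
    rw [setLIntegral_congr_fun (g := fun _ => ENNReal.ofReal (g u)) measurableSet_Ioc
      fun v hv => by simp only [max_eq_left hv.2]]
    rw [setLIntegral_const, Real.volume_Ioc, sub_zero, mul_comm, ENNReal.ofReal_mul hu.le]
  have h2 : ∫⁻ v in Ioc u b, ENNReal.ofReal (g (max u v)) = ENNReal.ofReal (f b - f u) := by
    rw [setLIntegral_congr_fun (g := fun v => ENNReal.ofReal (g v)) measurableSet_Ioc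
      fun v hv => by simp only [max_eq_right hv.1.le]]
    rw [← h.integral_slope u b hu hub hb, intervalIntegral.integral_of_le hub,
      ofReal_integral_eq_lintegral_ofReal
        ((intervalIntegrable_iff_integrableOn_Ioc_of_le hub).1 (h.intervalIntegrable u b hu hub hb))
        (.of_forall fun v => h.slope_nonneg v)]
  rw [← Ioc_union_Ioc_eq_Ioc hu.le hub, lintegral_union measurableSet_Ioc
      (Ioc_disjoint_Ioc_of_le le_rfl), h1, h2,
    ENNReal.ofReal_add (mul_nonneg hu.le (h.slope_nonneg u))
      (sub_nonneg.2 (h.monotoneOn_ratio hu hub hb))]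

/-- For fixed `u` the absolutely continuous part has mass `u g(u) + f(b) - f(u)`. The diagonal
density `f(u) - u g(u)` completes it to `f(b)`, independent of `u`. -/
lemma lintegral_slope_add_diagonal (h : IsSemilinearSlope f g) {a b : ℝ} (ha : 0 ≤ a)
    (hab : a ≤ b) (hb : b ≤ 1) :
    (∫⁻ u in Ioc 0 a, ∫⁻ v in Ioc 0 b, ENNReal.ofReal (g (max u v))) +
        ∫⁻ u in Ioc 0 a, ENNReal.ofReal (f u - u * g u) = ENNReal.ofReal (a * f b) := by
  have hf := h.measurable_ratio
  have hg := h.measurable_slope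
  rw [← lintegral_add_right _ (by fun_prop),
    setLIntegral_congr_fun (g := fun _ => ENNReal.ofReal (f b)) measurableSet_Ioc fun u hu => ?_,
    setLIntegral_const, Real.volume_Ioc, sub_zero, mul_comm, ENNReal.ofReal_mul ha]
  have hu1 := (hu.2.trans hab).trans hb
  have h1 := h.mul_slope_nonneg ⟨hu.1, hu1⟩
  have h2 := h.mul_slope_le u ⟨hu.1, hu1⟩
  have h3 := h.monotoneOn_ratio hu.1 (hu.2.trans hab) hb
  simp only [h.lintegral_slope_max hu.1 (hu.2.trans hab) hb]
  rw [← ENNReal.ofReal_add (by linarith) (by linarith)]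
  congr 1
  ring

theorem semilinearMeasure_prod (h : IsSemilinearSlope f g) {A B : Set ℝ}
    (hA : MeasurableSet A) (hB : MeasurableSet B) {a b : ℝ} (ha : A ∩ Ioc 0 1 = Ioc 0 a)
    (hb : B ∩ Ioc 0 1 = Ioc 0 b) (ha1 : a ∈ Icc (0 : ℝ) 1) (hb1 : b ∈ Icc (0 : ℝ) 1) :
    semilinearMeasure f g (A ×ˢ B) = ENNReal.ofReal (min a b * f (max a b)) := by
  rw [h.semilinearMeasure_prod_eq_add hA hB ha hb]
  rcases le_total a b with hab | hba
  · rw [min_eq_left hab, max_eq_right hab, h.lintegral_slope_add_diagonal ha1.1 hab hb1.2]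
  · rw [min_eq_right hba, max_eq_left hba, ← h.lintegral_slope_add_diagonal hb1.1 hba ha1.2,
      lintegral_lintegral_swap
        (h.measurable_slope.comp (measurable_fst.max measurable_snd)).ennreal_ofReal.aemeasurable]
    simp only [max_comm]

lemma Iic_inter_Ioc_clamp (x : ℝ) : Iic x ∩ Ioc 0 1 = Ioc 0 (max 0 (min 1 x)) := by
  rw [Iic_inter_Ioc_zero_one, min_comm]
  rcases le_total (min 1 x) 0 with hx | hx
  · rw [max_eq_left hx, Ioc_self, Ioc_eq_empty (not_lt.2 hx)]
  · rw [max_eq_right hx]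

theorem isProbabilityMeasure_semilinearMeasure (h : IsSemilinearSlope f g) :
    IsProbabilityMeasure (semilinearMeasure f g) := by
  constructor
  rw [← univ_prod_univ, h.semilinearMeasure_prod .univ .univ (univ_inter _) (univ_inter _)
    (by simp) (by simp)]
  simp [h.ratio_one]

theorem hasCopula_semilinearMeasure (h : IsSemilinearSlope f g) {C : ℝ → ℝ → ℝ}
    (hC : ∀ u ∈ Icc (0 : ℝ) 1, ∀ v ∈ Icc (0 : ℝ) 1, C u v = min u v * f (max u v)) :
    HasCopula (semilinearMeasure f g) Prod.fst Prod.snd C := by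
  have hc : ∀ x : ℝ, max 0 (min 1 x) ∈ Icc (0 : ℝ) 1 := fun x =>
    ⟨le_max_left _ _, max_le zero_le_one (min_le_left _ _)⟩
  have hfst : ∀ x : ℝ, (semilinearMeasure f g).real {ω | ω.1 ≤ x} = max 0 (min 1 x) := fun x => by
    have hs : {ω : ℝ × ℝ | ω.1 ≤ x} = Iic x ×ˢ univ := by ext; simp
    rw [measureReal_def, hs, h.semilinearMeasure_prod measurableSet_Iic .univ
      (Iic_inter_Ioc_clamp x) (univ_inter _) (hc x) (by simp), min_eq_left (hc x).2,
      max_eq_right (hc x).2, h.ratio_one, mul_one, ENNReal.toReal_ofReal (hc x).1]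
  have hsnd : ∀ x : ℝ, (semilinearMeasure f g).real {ω | ω.2 ≤ x} = max 0 (min 1 x) := fun x => by
    have hs : {ω : ℝ × ℝ | ω.2 ≤ x} = univ ×ˢ Iic x := by ext; simp
    rw [measureReal_def, hs, h.semilinearMeasure_prod .univ measurableSet_Iic (univ_inter _)
      (Iic_inter_Ioc_clamp x) (by simp) (hc x), min_eq_right (hc x).2,
      max_eq_left (hc x).2, h.ratio_one, mul_one, ENNReal.toReal_ofReal (hc x).1]
  refine ⟨measurable_fst, measurable_snd, ?_, ?_, fun x y => ?_⟩
  · simp only [hfst]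
    fun_prop
  · simp only [hsnd]
    fun_prop
  · have hs : {ω : ℝ × ℝ | ω.1 ≤ x ∧ ω.2 ≤ y} = Iic x ×ˢ Iic y := rfl
    rw [hfst, hsnd, hC _ (hc x) _ (hc y), measureReal_def, hs,
      h.semilinearMeasure_prod measurableSet_Iic measurableSet_Iic
      (Iic_inter_Ioc_clamp x) (Iic_inter_Ioc_clamp y) (hc x) (hc y), ENNReal.toReal_ofReal]
    exact mul_nonneg (le_min (hc x).1 (hc y).1) (h.ratio_nonneg _)

end IsSemilinearSlope

/-! ### Sharpness -/

/-- The diagonal `t * max c t`, at which the bound of Chatterjee's by Spearman's coefficient is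
attained. -/
lemma isLSLDiagonal_mul_max {c : ℝ} (hc : c ∈ Icc (0 : ℝ) 1) :
    IsLSLDiagonal fun t => t * max c t where
  mapsTo t ht := ⟨mul_nonneg ht.1 (hc.1.trans (le_max_left _ _)),
    mul_le_one₀ ht.2 (hc.1.trans (le_max_left _ _)) (max_le hc.2 ht.2)⟩
  monotoneOn s hs t ht hst := mul_le_mul hst (max_le_max le_rfl hst)
    (hc.1.trans (le_max_left _ _)) ht.1
  lipschitzOn := by
    refine LipschitzOnWith.of_dist_le_mul fun s hs t ht => ?_
    simp only [Real.dist_eq, NNReal.coe_ofNat]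
    have h1 : |max c s - max c t| ≤ |s - t| := by
      simpa [max_comm] using abs_max_sub_max_le_abs s t c
    have h2 : |max c s| ≤ 1 := by
      rw [abs_of_nonneg (hc.1.trans (le_max_left _ _))]
      exact max_le hc.2 hs.2
    have h3 : |t| ≤ 1 := by
      rw [abs_of_nonneg ht.1]
      exact ht.2
    calc |s * max c s - t * max c t|
        = |(s - t) * max c s + t * (max c s - max c t)| := by ring_nf
      _ ≤ |s - t| * |max c s| + |t| * |max c s - max c t| := by
          rw [← abs_mul, ← abs_mul]
          exact abs_add_le _ _
      _ ≤ |s - t| * 1 + 1 * |s - t| := by gcongr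
      _ = 2 * |s - t| := by ring
  le_self t ht := mul_le_of_le_one_right ht.1 (max_le hc.2 ht.2)
  map_one := by simp [hc.2]
  monotoneOn_div s hs t ht hst := by
    simp only [mul_div_cancel_left₀ _ hs.1.ne', mul_div_cancel_left₀ _ ht.1.ne']
    exact max_le_max le_rfl hst
  antitoneOn_div_sq s hs t ht hst := by
    have heq : ∀ x ∈ Ioc (0 : ℝ) 1, x * max c x / x ^ 2 = max (c / x) 1 := fun x hx => by
      rw [sq, mul_div_mul_left _ _ hx.1.ne', ← max_div_div_right hx.1.le, div_self hx.1.ne']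
    simp only [heq s hs, heq t ht]
    exact max_le_max (div_le_div_of_nonneg_left hc.1 hs.1 hst) le_rfl

lemma diagRatio_mul_max {c u : ℝ} (hu : u ∈ Ioc (0 : ℝ) 1) :
    diagRatio (fun t => t * max c t) u = max c u := by
  rw [IsLSLDiagonal.diagRatio_eq hu, mul_div_cancel_left₀ _ hu.1.ne']

/-- The slope of `t * max c t` vanishes below `c`, and the ratio is the identity above. -/
lemma diagSlope_mul_max {c u : ℝ} (hu : u ∈ Ioc (0 : ℝ) 1) (huc : u ≠ c) :
    diagSlope (fun t => t * max c t) u = 0 ∨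
      (diagSlope (fun t => t * max c t) u = 1 ∧ max c u = u) := by
  by_cases hd : u ∈ Ioo (0 : ℝ) 1 ∧
      DifferentiableAt ℝ (fun t => (fun t => t * max c t) (max 0 (min 1 t))) u
  · have h1 := IsLSLDiagonal.hasDerivAt_ratio (δ := fun t => t * max c t) hd.1 hd.2
    rcases lt_or_gt_of_ne huc with hlt | hgt
    · left
      refine h1.unique ((hasDerivAt_const u c).congr_of_eventuallyEq ?_)
      filter_upwards [isOpen_Ioo.mem_nhds (show u ∈ Ioo 0 c from ⟨hu.1, hlt⟩)] with t ht
      rw [mul_div_cancel_left₀ _ ht.1.ne', max_eq_left ht.2.le]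
    · right
      refine ⟨h1.unique ((hasDerivAt_id u).congr_of_eventuallyEq ?_), max_eq_right hgt.le⟩
      filter_upwards [isOpen_Ioi.mem_nhds hgt, isOpen_Ioi.mem_nhds hu.1] with t ht ht0
      rw [mul_div_cancel_left₀ _ (ne_of_gt ht0), max_eq_right (le_of_lt ht), id]
  -- The slope is zero by convention here; this covers the endpoint `u = 1`.
  · left
    rw [diagSlope, if_neg hd]

lemma integral_sq_mul_max {c : ℝ} (hc : c ∈ Icc (0 : ℝ) 1) :
    ∫ u in Ioc (0 : ℝ) 1, u ^ 2 * max c u = 1 / 4 + c ^ 4 / 12 := by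
  have hcont : Continuous fun u : ℝ => u ^ 2 * max c u := by fun_prop
  rw [← intervalIntegral.integral_of_le zero_le_one,
    ← intervalIntegral.integral_add_adjacent_intervals (hcont.intervalIntegrable 0 c)
      (hcont.intervalIntegrable c 1),
    intervalIntegral.integral_congr (g := fun u => u ^ 2 * c) fun u hu => ?_,
    intervalIntegral.integral_congr (a := c) (g := fun u => u ^ 3) fun u hu => ?_,
    intervalIntegral.integral_mul_const, integral_pow, integral_pow]
  · norm_num
    ring
  · rw [uIcc_of_le hc.2] at hu
    simp only [max_eq_right hu.1]
    ring
  · rw [uIcc_of_le hc.1] at hu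
    simp only [max_eq_left hu.2]

theorem spearmanRho_mul_max {c : ℝ} (hc : c ∈ Icc (0 : ℝ) 1) :
    spearmanRho (lslCopula fun t => t * max c t) = c ^ 4 := by
  rw [(isLSLDiagonal_mul_max hc).isSemilinearSlope.spearmanRho_eq
      fun _ hu _ hv => IsLSLDiagonal.lslCopula_eq hu hv,
    setIntegral_congr_fun (g := fun u => u ^ 2 * max c u) measurableSet_Ioc
      fun u hu => by simp only [diagRatio_mul_max hu],
    integral_sq_mul_max hc]
  ring

/-- The integrand of the gap vanishes off `u = c`: either `g = 0`, or `f = u` and `g = 1`, in which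
case `3 f - 2 u - u g = 0`. -/
theorem chatterjeeXi_mul_max {c : ℝ} (hc : c ∈ Icc (0 : ℝ) 1)
    {Ω : Type*} [MeasurableSpace Ω] {P : Measure Ω} [IsProbabilityMeasure P] {X Y : Ω → ℝ}
    (hXY : HasCopula P X Y (lslCopula fun t => t * max c t)) :
    chatterjeeXi P X Y = c ^ 4 := by
  have hgap := (isLSLDiagonal_mul_max hc).isSemilinearSlope.spearmanRho_sub_chatterjeeXi
    (fun _ hu _ hv => IsLSLDiagonal.lslCopula_eq hu hv) hXY
  have hne : ∀ᵐ u : ℝ, u ≠ c := by simp [ae_iff, measure_singleton]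
  rw [setIntegral_congr_ae (g := fun _ => 0) measurableSet_Ioc, integral_zero, sub_eq_zero,
    spearmanRho_mul_max hc] at hgap
  · exact hgap.symm
  · filter_upwards [hne] with u huc hu
    rw [diagRatio_mul_max hu]
    rcases diagSlope_mul_max hu huc with h0 | ⟨h1, h2⟩
    · rw [h0]
      ring
    · rw [h1, h2]
      ring

/-- For every lower semilinear copula `S_δ`, pairs `(X, Y)` with copula `S_δ` exist, and every such
pair satisfies `ξ ≤ ρ(S_δ)`. The inequality is sharp: at every level `r ∈ [0,1]` there is a lower
semilinear copula with `ξ = ρ = r`. -/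
theorem corollary4p4 :
    (∀ δ : ℝ → ℝ, IsLSLDiagonal δ →
      (∃ μ : Measure (ℝ × ℝ), IsProbabilityMeasure μ ∧
        HasCopula μ Prod.fst Prod.snd (lslCopula δ)) ∧
      ∀ (Ω : Type*) [MeasurableSpace Ω] (P : Measure Ω) [IsProbabilityMeasure P] (X Y : Ω → ℝ),
        HasCopula P X Y (lslCopula δ) → chatterjeeXi P X Y ≤ spearmanRho (lslCopula δ)) ∧
    (∀ r ∈ Icc (0 : ℝ) 1, ∃ δ : ℝ → ℝ, IsLSLDiagonal δ ∧
      spearmanRho (lslCopula δ) = r ∧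
      ∀ (Ω : Type*) [MeasurableSpace Ω] (P : Measure Ω) [IsProbabilityMeasure P] (X Y : Ω → ℝ),
        HasCopula P X Y (lslCopula δ) → chatterjeeXi P X Y = r) := by
  refine ⟨fun δ hδ => ⟨?_, fun Ω _ P _ X Y hXY => ?_⟩, fun r hr => ?_⟩
  · exact ⟨semilinearMeasure (diagRatio δ) (diagSlope δ),
      hδ.isSemilinearSlope.isProbabilityMeasure_semilinearMeasure,
      hδ.isSemilinearSlope.hasCopula_semilinearMeasure
        fun _ hu _ hv => IsLSLDiagonal.lslCopula_eq hu hv⟩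
  · exact hδ.isSemilinearSlope.chatterjeeXi_le_spearmanRho
      (fun _ hu _ hv => IsLSLDiagonal.lslCopula_eq hu hv) hXY
  -- Both coefficients equal `c ^ 4`, so a fourth root of `r` is required.
  · obtain ⟨c, hc, rfl⟩ : ∃ c ∈ Icc (0 : ℝ) 1, c ^ 4 = r :=
      intermediate_value_Icc zero_le_one (continuous_pow 4).continuousOn (by simpa using hr)
    exact ⟨_, isLSLDiagonal_mul_max hc, spearmanRho_mul_max hc,
      fun Ω _ P _ X Y hXY => chatterjeeXi_mul_max hc hXY⟩
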